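/- Let $(\mathcal M,\omega)$ be a $2N$-dimensional smooth symplectic manifold (without boundary), i.e. $\omega$ is a smooth, closed, nondegenerate $2$-form on $\mathcal M$. Let $H\in C^\infty(\mathcal M)$, and let $X_H$ be the Hamiltonian vector field, uniquely defined by $\iota_{X_H}\omega=\mathrm dH$. Let $\Omega=\omega^N/N!$ be the Liouville volume form ($\omega^N$ is the $N$-fold wedge power), and for a smooth vector field $X$ let $\mathrm{div}_\Omega X$ denote the function with $\mathcal L_X\Omega=(\mathrm{div}_\Omega X)\,\Omega$, where $\mathcal L$ is the Lie derivative. Then $\Omega$ is a smooth nowhere vanishing form of top degree (so that $\mathrm{div}_\Omega X$ exists and is unique for every smooth vector field $X$), $X_H$ is smooth, and the Hamiltonian flow preserves $\Omega$: $$\mathcal L_{X_H}\Omega=0 .$$ Consequently $\Phi_t^*\Omega=\Omega$, wherever $\Phi_t$ is defined, for every smooth local flow $\Phi$ of $X_H$. Equivalently, $$\mathrm{div}_\Omega X_H=0 ,$$ i.e. the flow is incompressible in the Liouville sense; here, for every smooth vector field $X$ on $\mathcal M$, $\mathcal L_X\Omega=0$ if and only if $\mathrm{div}_\Omega X=0$.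 -/

import Mathlib

open scoped Manifold

noncomputable section

namespace LiouvilleTheorem

/-! ### Exterior algebra on a vector space -/

section Algebra

variable {V : Type*} [AddCommGroup V] [Module ℝ V] [TopologicalSpace V]

/-- The tensor product of two alternating forms,
`(v₁, …, v_{k+l}) ↦ α (v₁, …, v_k) * β (v_{k+1}, …, v_{k+l})`. -/
def tensorForm {k l : ℕ} (α : V [⋀^Fin k]→L[ℝ] ℝ) (β : V [⋀^Fin l]→L[ℝ] ℝ) :
    ContinuousMultilinearMap ℝ (fun _ : Fin (k + l) => V) ℝ where
  toMultilinearMap :=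
    ((LinearMap.mul' ℝ ℝ).compMultilinearMap
      (MultilinearMap.domCoprod α.toMultilinearMap β.toMultilinearMap)).domDomCongr finSumFinEquiv
  cont := by
    have h : Continuous fun v : Fin (k + l) → V =>
        α (fun i => v (Fin.castAdd l i)) * β (fun j => v (Fin.natAdd k j)) :=
      (α.cont.comp (by fun_prop)).mul (β.cont.comp (by fun_prop))
    exact h

theorem tensorForm_apply {k l : ℕ} (α : V [⋀^Fin k]→L[ℝ] ℝ) (β : V [⋀^Fin l]→L[ℝ] ℝ)
    (v : Fin (k + l) → V) :
    tensorForm α β v = α (fun i => v (Fin.castAdd l i)) * β (fun j => v (Fin.natAdd k j)) :=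
  rfl

variable [IsTopologicalAddGroup V] [ContinuousConstSMul ℝ V]

/-- The wedge product, normalised as in `dx ∧ dy = dx ⊗ dy - dy ⊗ dx`:
`(α ∧ β) (v) = 1 / (k! l!) * ∑ σ, sign σ * α (v_{σ 1}, …, v_{σ k}) * β (v_{σ (k+1)}, …)`. -/
def wedge {k l : ℕ} (α : V [⋀^Fin k]→L[ℝ] ℝ) (β : V [⋀^Fin l]→L[ℝ] ℝ) :
    V [⋀^Fin (k + l)]→L[ℝ] ℝ :=
  ((k.factorial : ℝ) * (l.factorial : ℝ))⁻¹ •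
    ContinuousMultilinearMap.alternatization (tensorForm α β)

/-- The wedge power `ω ∧ ⋯ ∧ ω` (`N` factors) of a `2`-form; the power for `N = 0` is `1`. -/
def wedgePow (ω : V [⋀^Fin 2]→L[ℝ] ℝ) : (N : ℕ) → V [⋀^Fin (2 * N)]→L[ℝ] ℝ
  | 0 => ContinuousAlternatingMap.constOfIsEmpty ℝ V (Fin 0) (1 : ℝ)
  | N + 1 => wedge (wedgePow ω N) ω

end Algebra

/-! ### Lie derivative on a normed space -/

/-- The Lie derivative of a differential form `η` along a vector field `X` on a normed space,
`(L_X η)_{a₁ … a_k} = X^c ∂_c η_{a₁ … a_k} + ∑ i, η_{a₁ … c … a_k} ∂_{a_i} X^c`.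
The second term is the derivative of `A ↦ A^* η` at `A = id` in the direction `D X`. -/
def lieDerivFlat {E : Type*} [NormedAddCommGroup E] [NormedSpace ℝ E] {k : ℕ}
    (X : E → E) (η : E → E [⋀^Fin k]→L[ℝ] ℝ) (y : E) : E [⋀^Fin k]→L[ℝ] ℝ :=
  fderiv ℝ η y (X y) +
    (η y).fderivCompContinuousLinearMap (ContinuousLinearMap.id ℝ E) (fderiv ℝ X y)

theorem lieDerivFlat_apply {E : Type*} [NormedAddCommGroup E] [NormedSpace ℝ E] {k : ℕ}
    (X : E → E) (η : E → E [⋀^Fin k]→L[ℝ] ℝ) (y : E) (v : Fin k → E) :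
    lieDerivFlat X η y v =
      fderiv ℝ η y (X y) v + ∑ i, η y (Function.update v i (fderiv ℝ X y (v i))) := by
  simp only [lieDerivFlat, ContinuousAlternatingMap.add_apply,
    ContinuousAlternatingMap.fderivCompContinuousLinearMap_apply]
  congr 1
  refine Finset.sum_congr rfl fun i _ => ?_
  congr 1
  ext j : 1
  by_cases h : j = i
  · subst h; simp
  · simp [h]

/-! ### Differential forms and vector fields on a manifold -/

/-- The model space `ℝⁿ`. -/
abbrev Rn (n : ℕ) : Type := EuclideanSpace ℝ (Fin n)

section Manifold

variable {n : ℕ} {M : Type*} [TopologicalSpace M] [ChartedSpace (Rn n) M]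

variable (n M) in
/-- A (not necessarily continuous) vector field on an `n`-dimensional manifold. -/
abbrev VField : Type _ := (x : M) → TangentSpace (𝓡 n) x

variable (n M) in
/-- A (not necessarily continuous) differential `k`-form on an `n`-dimensional manifold. -/
abbrev DForm (k : ℕ) : Type _ := (x : M) → (TangentSpace (𝓡 n) x) [⋀^Fin k]→L[ℝ] ℝ

/-- A smooth vector field. -/
def IsSmoothVField [IsManifold (𝓡 n) (⊤ : ℕ∞) M] (X : VField n M) : Prop :=
  ContMDiff (𝓡 n) (𝓡 n).tangent (⊤ : ℕ∞) fun x => (⟨x, X x⟩ : TangentBundle (𝓡 n) M)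

/-- The derivative at `x` of the preferred chart at `x₀`, a linear map `T_x M → ℝⁿ`. -/
def chartD (x₀ x : M) : TangentSpace (𝓡 n) x →L[ℝ] Rn n :=
  mfderiv (𝓡 n) 𝓘(ℝ, Rn n) (extChartAt (𝓡 n) x₀) x

/-- The derivative at `y` of the inverse of the preferred chart at `x₀`. -/
def chartSymmD (x₀ : M) (y : Rn n) :
    Rn n →L[ℝ] TangentSpace (𝓡 n) ((extChartAt (𝓡 n) x₀).symm y) :=
  mfderiv 𝓘(ℝ, Rn n) (𝓡 n) (extChartAt (𝓡 n) x₀).symm y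

/-- The vector field `X` read in the preferred chart at `x₀`: its pushforward under the chart.
Only its values on the target of the chart matter. -/
def vfieldInChart (X : VField n M) (x₀ : M) (y : Rn n) : Rn n :=
  chartD x₀ ((extChartAt (𝓡 n) x₀).symm y) (X ((extChartAt (𝓡 n) x₀).symm y))

/-- The differential form `η` read in the preferred chart at `x₀`: the pullback of `η` under the
inverse of the chart. Only its values on the target of the chart matter. -/
def formInChart {k : ℕ} (η : DForm n M k) (x₀ : M) (y : Rn n) : (Rn n) [⋀^Fin k]→L[ℝ] ℝ :=
  (η ((extChartAt (𝓡 n) x₀).symm y)).compContinuousLinearMap (chartSymmD x₀ y)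

/-- A smooth differential form: its expressions in the charts are smooth. -/
def IsSmoothForm {k : ℕ} (η : DForm n M k) : Prop :=
  ∀ x₀ : M, ContDiffOn ℝ (⊤ : ℕ∞) (formInChart η x₀) (extChartAt (𝓡 n) x₀).target

/-- The exterior derivative, computed at each point in the preferred chart at that point. -/
def extDerivM {k : ℕ} (η : DForm n M k) : DForm n M (k + 1) := fun x =>
  (extDeriv (formInChart η x) (extChartAt (𝓡 n) x x)).compContinuousLinearMap (chartD x x)

/-- The Lie derivative `L_X η`, computed at each point in the preferred chart at that point. -/
def lieDeriv {k : ℕ} (X : VField n M) (η : DForm n M k) : DForm n M k := fun x =>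
  (lieDerivFlat (vfieldInChart X x) (formInChart η x)
      (extChartAt (𝓡 n) x x)).compContinuousLinearMap (chartD x x)

/-- The pullback `f^* η` of a differential form under a self-map `f` of the manifold. -/
def pullbackForm {k : ℕ} (f : M → M) (η : DForm n M k) : DForm n M k := fun x =>
  (η (f x)).compContinuousLinearMap (mfderiv (𝓡 n) (𝓡 n) f x)

/-- The divergence of `X` with respect to a volume form `Ω`, i.e. the function `div_Ω X` with
`L_X Ω = (div_Ω X) Ω`. (At each point it is unique where `Ω` does not vanish, as the space of
forms of top degree is one-dimensional.) -/
def divergence (Ω : DForm n M n) (X : VField n M) : M → ℝ := fun x =>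
  Classical.epsilon fun c : ℝ => lieDeriv X Ω x = c • Ω x

/-- `Φ` is a smooth local flow of the vector field `X` with flow domain `U ⊆ ℝ × M`: `U` is open,
for each `x` the set of times `{t | (t, x) ∈ U}` is empty or an interval that contains `0`,
`Φ` is smooth on `U`, `Φ 0 x = x`, and `t ↦ Φ t x` is an integral curve of `X`.
The values of `Φ` outside `U` are irrelevant. -/
structure IsLocalFlow (X : VField n M) (U : Set (ℝ × M)) (Φ : ℝ → M → M) : Prop where
  isOpen : IsOpen U
  zero_mem : ∀ t x, (t, x) ∈ U → ((0 : ℝ), x) ∈ U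
  ordConnected : ∀ x, Set.OrdConnected {t : ℝ | (t, x) ∈ U}
  smooth : ContMDiffOn (𝓘(ℝ, ℝ).prod (𝓡 n)) (𝓡 n) (⊤ : ℕ∞) (fun p : ℝ × M => Φ p.1 p.2) U
  map_zero : ∀ x, ((0 : ℝ), x) ∈ U → Φ 0 x = x
  integralCurve : ∀ x, IsMIntegralCurveOn (fun t => Φ t x) X {t : ℝ | (t, x) ∈ U}

variable (n M) in
/-- A symplectic form: a smooth, closed, nondegenerate `2`-form. -/
structure SymplecticForm where
  toForm : DForm n M 2
  smooth : IsSmoothForm toForm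
  closed : extDerivM toForm = 0
  nondegenerate : ∀ (x : M) (v : TangentSpace (𝓡 n) x), (∀ w, toForm x ![v, w] = 0) → v = 0

/-- Nondegeneracy: every covector is the contraction of `ω` with exactly one tangent vector. -/
theorem SymplecticForm.existsUnique_contract (ω : SymplecticForm n M) (x : M)
    (θ : TangentSpace (𝓡 n) x →L[ℝ] ℝ) :
    ∃! v : TangentSpace (𝓡 n) x, ∀ w, ω.toForm x ![v, w] = θ w := by
  have : FiniteDimensional ℝ (TangentSpace (𝓡 n) x) :=
    inferInstanceAs (FiniteDimensional ℝ (Rn n))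
  have hadd : ∀ u v w : TangentSpace (𝓡 n) x,
      ω.toForm x ![u + v, w] = ω.toForm x ![u, w] + ω.toForm x ![v, w] :=
    fun u v w => (ω.toForm x).toMultilinearMap.cons_add ![w] u v
  have hsmul : ∀ (c : ℝ) (v w : TangentSpace (𝓡 n) x),
      ω.toForm x ![c • v, w] = c * ω.toForm x ![v, w] :=
    fun c v w => (ω.toForm x).toMultilinearMap.cons_smul ![w] c v
  have hswap : ∀ v w : TangentSpace (𝓡 n) x, ω.toForm x ![v, w] = -ω.toForm x ![w, v] := by
    intro v w
    have h := (ω.toForm x).toAlternatingMap.map_swap ![w, v] (i := 0) (j := 1) (by decide)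
    rw [← show (![w, v] ∘ ⇑(Equiv.swap (0 : Fin 2) 1)) = ![v, w] from by
      ext i : 1; fin_cases i <;> simp]
    exact h
  let flat : TangentSpace (𝓡 n) x →ₗ[ℝ] Module.Dual ℝ (TangentSpace (𝓡 n) x) :=
    LinearMap.mk₂ ℝ (fun v w => ω.toForm x ![v, w]) hadd hsmul
      (fun v w w' => by rw [hswap v, hadd, hswap w, hswap w']; ring)
      (fun c v w => by rw [hswap v, hsmul, hswap w]; simp)
  have hinj : Function.Injective flat := by
    rw [← LinearMap.ker_eq_bot, LinearMap.ker_eq_bot']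
    exact fun v hv => ω.nondegenerate x v fun w => LinearMap.congr_fun hv w
  have hsurj : Function.Surjective flat :=
    (LinearMap.injective_iff_surjective_of_finrank_eq_finrank
      (Subspace.dual_finrank_eq (K := ℝ) (V := TangentSpace (𝓡 n) x)).symm).1 hinj
  obtain ⟨v, hv⟩ := hsurj (θ : TangentSpace (𝓡 n) x →ₗ[ℝ] ℝ)
  refine ⟨v, fun w => LinearMap.congr_fun hv w, fun v' hv' => hinj ?_⟩
  rw [hv]
  exact LinearMap.ext hv'

/-- The differential `dH` of a function at a point, as a covector. -/
def differential (H : M → ℝ) (x : M) : TangentSpace (𝓡 n) x →L[ℝ] ℝ :=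
  mfderiv (𝓡 n) 𝓘(ℝ, ℝ) H x

/-- The Hamiltonian vector field `X_H`: the unique vector field with `ι_{X_H} ω = dH`. -/
def hamiltonianVField (ω : SymplecticForm n M) (H : M → ℝ) : VField n M := fun x =>
  (ω.existsUnique_contract x (differential H x)).choose

theorem hamiltonianVField_spec (ω : SymplecticForm n M) (H : M → ℝ) (x : M)
    (w : TangentSpace (𝓡 n) x) :
    ω.toForm x ![hamiltonianVField ω H x, w] = differential H x w :=
  (ω.existsUnique_contract x (differential H x)).choose_spec.1 w

end Manifold

/-- The Liouville form `Ω = ω^N / N!` of a symplectic manifold of dimension `2N`. -/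
def liouvilleForm {N : ℕ} {M : Type*} [TopologicalSpace M] [ChartedSpace (Rn (2 * N)) M]
    (ω : SymplecticForm (2 * N) M) : DForm (2 * N) M (2 * N) := fun x =>
  (N.factorial : ℝ)⁻¹ • wedgePow (ω.toForm x) N

end LiouvilleTheorem

end

/-!
Cartan's formula gives `L_X ω = ι_X dω + d (ι_X ω) = 0 + d (dH) = 0` for the Hamiltonian vector
field `X` of `H`. Since `L_X` is a derivation of the wedge product, `L_X (ω ^ N) = 0`. Both facts
are computed in the preferred chart at a point, where the forms and the vector field are functions
on the model space: `lieDerivFlat_eq_zero_of_hamiltonian` and `lieDerivFlat_wedgePow_eq_zero`.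

That `ω ^ N` vanishes nowhere is linear algebra. A nondegenerate alternating form on a space of
dimension `2 * N` has `N` orthogonal hyperbolic pairs (`exists_symplectic_family`), and `ω ^ N` is
a positive multiple of the sum over permutations `σ` of
`sign σ * ∏ i, ω (v (σ (2 * i)), v (σ (2 * i + 1)))` (`wedgePow_apply`). On a symplectic basis no
term of this sum is negative (`sign_mul_prod_nonneg`), and that of the identity is `1`. As forms
of top degree are unique up to a factor, the divergence is then well defined, and it vanishes
exactly when `L_X Ω` does.

In a chart `X` is the image of `dH` under the inverse of the linear map `v ↦ ω (v, ·)`, and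
inversion of linear maps is smooth, so `X` is smooth (`contDiffAt_of_contract`).

For a local flow `Φ` of `X`, the function `t ↦ (Φ_t^* Ω)_x` takes values in a fixed
vector space, and its derivative at `t` is `Φ_t^* (L_X Ω)` at `x`, which is zero
(`hasDerivAt_pullback_flow`, applied in the chart centred at `Φ_t x`). It is therefore constant on
the interval of times at which the flow is defined, and its value at time `0` is `Ω_x`.
-/

noncomputable section

namespace LiouvilleTheorem

/-! ### The wedge product: naturality and bilinearity -/

section Wedge

variable {V W : Type*} [AddCommGroup V] [Module ℝ V] [TopologicalSpace V]
  [AddCommGroup W] [Module ℝ W] [TopologicalSpace W]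

theorem wedge_apply {k l : ℕ} (α : V [⋀^Fin k]→L[ℝ] ℝ) (β : V [⋀^Fin l]→L[ℝ] ℝ)
    (v : Fin (k + l) → V) :
    wedge α β v = ((k.factorial : ℝ) * (l.factorial : ℝ))⁻¹ *
      ∑ σ : Equiv.Perm (Fin (k + l)), ((Equiv.Perm.sign σ : ℤ) : ℝ) *
        (α (fun i => v (σ (Fin.castAdd l i))) * β (fun j => v (σ (Fin.natAdd k j)))) := by
  simp only [wedge, ContinuousAlternatingMap.smul_apply,
    ContinuousMultilinearMap.alternatization_apply_apply, tensorForm_apply, smul_eq_mul,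
    Function.comp_apply, Units.smul_def, zsmul_eq_mul]

theorem wedge_compContinuousLinearMap {k l : ℕ} (α : V [⋀^Fin k]→L[ℝ] ℝ)
    (β : V [⋀^Fin l]→L[ℝ] ℝ) (f : W →L[ℝ] V) :
    (wedge α β).compContinuousLinearMap f =
      wedge (α.compContinuousLinearMap f) (β.compContinuousLinearMap f) := by
  ext v
  simp only [wedge_apply, ContinuousAlternatingMap.compContinuousLinearMap_apply,
    Function.comp_def]

theorem wedgePow_compContinuousLinearMap (ω : V [⋀^Fin 2]→L[ℝ] ℝ) (f : W →L[ℝ] V) (N : ℕ) :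
    (wedgePow ω N).compContinuousLinearMap f = wedgePow (ω.compContinuousLinearMap f) N := by
  induction N with
  | zero => ext v; rfl
  | succ N ih => simp only [wedgePow]; rw [wedge_compContinuousLinearMap, ih]

end Wedge

section WedgeNormed

variable {E : Type*} [NormedAddCommGroup E] [NormedSpace ℝ E]

/-- The wedge product as a bounded bilinear map. -/
def wedgeL (E : Type*) [NormedAddCommGroup E] [NormedSpace ℝ E] (k l : ℕ) :
    (E [⋀^Fin k]→L[ℝ] ℝ) →L[ℝ] (E [⋀^Fin l]→L[ℝ] ℝ) →L[ℝ] (E [⋀^Fin (k + l)]→L[ℝ] ℝ) :=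
  LinearMap.mkContinuous₂
    (LinearMap.mk₂ ℝ wedge
      (fun α α' β => by
        ext v
        simp only [wedge_apply, ContinuousAlternatingMap.add_apply, ← mul_add,
          ← Finset.sum_add_distrib, add_mul])
      (fun c α β => by
        ext v
        simp only [wedge_apply, ContinuousAlternatingMap.smul_apply, smul_eq_mul, Finset.mul_sum]
        exact Finset.sum_congr rfl fun _ _ => by ring)
      (fun α β β' => by
        ext v
        simp only [wedge_apply, ContinuousAlternatingMap.add_apply, ← mul_add,
          ← Finset.sum_add_distrib])
      (fun c α β => by
        ext v
        simp only [wedge_apply, ContinuousAlternatingMap.smul_apply, smul_eq_mul, Finset.mul_sum]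
        exact Finset.sum_congr rfl fun _ _ => by ring))
    (((k.factorial : ℝ) * (l.factorial : ℝ))⁻¹ * ((k + l).factorial : ℝ)) <| by
      intro α β
      refine ContinuousAlternatingMap.opNorm_le_bound _ (by positivity) fun v => ?_
      have hterm : ∀ σ : Equiv.Perm (Fin (k + l)),
          ‖((Equiv.Perm.sign σ : ℤ) : ℝ) *
            (α (fun i => v (σ (Fin.castAdd l i))) * β (fun j => v (σ (Fin.natAdd k j))))‖ ≤
          ‖α‖ * ‖β‖ * ∏ i, ‖v i‖ := by
        intro σ
        have hs : ‖((Equiv.Perm.sign σ : ℤ) : ℝ)‖ = 1 := by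
          rcases Int.units_eq_one_or (Equiv.Perm.sign σ) with h | h <;> simp [h]
        rw [norm_mul, hs, one_mul, norm_mul, ← Equiv.prod_comp σ (fun i => ‖v i‖),
          Fin.prod_univ_add, mul_mul_mul_comm]
        exact mul_le_mul (α.le_opNorm _) (β.le_opNorm _) (norm_nonneg _) (by positivity)
      rw [LinearMap.mk₂_apply, wedge_apply, norm_mul,
        Real.norm_of_nonneg (by positivity : (0 : ℝ) ≤ ((k.factorial : ℝ) * l.factorial)⁻¹)]
      have hsum := (norm_sum_le Finset.univ _).trans (Finset.sum_le_sum fun σ _ => hterm σ)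
      rw [Finset.sum_const, Finset.card_univ, Fintype.card_perm, Fintype.card_fin,
        nsmul_eq_mul] at hsum
      calc _ ≤ ((k.factorial : ℝ) * (l.factorial : ℝ))⁻¹ *
            (((k + l).factorial : ℝ) * (‖α‖ * ‖β‖ * ∏ i, ‖v i‖)) := by gcongr
        _ = _ := by ring

@[simp]
theorem wedgeL_apply {k l : ℕ} (α : E [⋀^Fin k]→L[ℝ] ℝ) (β : E [⋀^Fin l]→L[ℝ] ℝ) :
    wedgeL E k l α β = wedge α β := rfl

/-- Pulling back by `id + t A` and differentiating at `t = 0` is a derivation of the wedge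
product. -/
theorem fderivCompContinuousLinearMap_wedge {k l : ℕ} (α : E [⋀^Fin k]→L[ℝ] ℝ)
    (β : E [⋀^Fin l]→L[ℝ] ℝ) (A : E →L[ℝ] E) :
    (wedge α β).fderivCompContinuousLinearMap (ContinuousLinearMap.id ℝ E) A =
      wedge (α.fderivCompContinuousLinearMap (ContinuousLinearMap.id ℝ E) A) β +
        wedge α (β.fderivCompContinuousLinearMap (ContinuousLinearMap.id ℝ E) A) := by
  have key : ∀ {m : ℕ} (γ : E [⋀^Fin m]→L[ℝ] ℝ),
      HasFDerivAt (fun B : E →L[ℝ] E => γ.compContinuousLinearMap B)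
        (γ.fderivCompContinuousLinearMap (ContinuousLinearMap.id ℝ E))
        (ContinuousLinearMap.id ℝ E) := by
    intro m γ
    have h := (hasFDerivAt_const γ (ContinuousLinearMap.id ℝ E)
      ).continuousAlternatingMapCompContinuousLinearMap (hasFDerivAt_id (𝕜 := ℝ) _)
    simpa using! h
  have h1 := key (wedge α β)
  have h2 := (wedgeL E k l).hasFDerivAt_of_bilinear (key α) (key β)
  simp only [wedge_compContinuousLinearMap] at h1
  have h3 := ContinuousLinearMap.ext_iff.1 (h1.unique h2) A
  have hid : ∀ {m : ℕ} (γ : E [⋀^Fin m]→L[ℝ] ℝ),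
      γ.compContinuousLinearMap (ContinuousLinearMap.id ℝ E) = γ := fun γ => by ext v; rfl
  rw [h3, hid, hid]
  simp [ContinuousLinearMap.precompR, ContinuousLinearMap.precompL, add_comm]

/-- The Lie derivative is a derivation of the wedge product. -/
theorem lieDerivFlat_wedge {k l : ℕ} (X : E → E) {α : E → E [⋀^Fin k]→L[ℝ] ℝ}
    {β : E → E [⋀^Fin l]→L[ℝ] ℝ} {y : E} (hα : DifferentiableAt ℝ α y)
    (hβ : DifferentiableAt ℝ β y) :
    lieDerivFlat X (fun z => wedge (α z) (β z)) y =
      wedge (lieDerivFlat X α y) (β y) + wedge (α y) (lieDerivFlat X β y) := by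
  have h := ((wedgeL E k l).hasFDerivAt_of_bilinear hα.hasFDerivAt hβ.hasFDerivAt).fderiv
  simp only [wedgeL_apply] at h
  simp only [lieDerivFlat, h, fderivCompContinuousLinearMap_wedge]
  simp only [← wedgeL_apply, map_add, add_apply,
    ContinuousLinearMap.precompR_apply, ContinuousLinearMap.precompL_apply,
    ContinuousLinearMap.compL_apply, ContinuousLinearMap.comp_apply]
  abel

theorem contDiff_wedgePow (n : WithTop ℕ∞) (N : ℕ) :
    ContDiff ℝ n fun ω : E [⋀^Fin 2]→L[ℝ] ℝ => wedgePow ω N := by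
  induction N with
  | zero => exact contDiff_const
  | succ N ih =>
    simp only [wedgePow]
    exact ((wedgeL E (2 * N) 2).contDiff.comp ih).clm_apply contDiff_id

/-- If the flow of `X` preserves `ω` infinitesimally, it preserves all wedge powers of `ω`. -/
theorem lieDerivFlat_wedgePow_eq_zero (X : E → E) {ω : E → E [⋀^Fin 2]→L[ℝ] ℝ} {y : E}
    (hω : DifferentiableAt ℝ ω y) (h : lieDerivFlat X ω y = 0) (N : ℕ) :
    lieDerivFlat X (fun z => wedgePow (ω z) N) y = 0 := by
  induction N with
  | zero =>
    ext v
    simp only [wedgePow, lieDerivFlat_apply]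
    simp
  | succ N ih =>
    have hN : DifferentiableAt ℝ (fun z => wedgePow (ω z) N) y :=
      ((contDiff_wedgePow 1 N).differentiable one_ne_zero _).comp y hω
    simp only [wedgePow]
    rw [lieDerivFlat_wedge X hN hω, ih, h]
    simp only [← wedgeL_apply, map_zero, zero_apply, add_zero]

theorem lieDerivFlat_const_smul {k : ℕ} (X : E → E) (c : ℝ) {η : E → E [⋀^Fin k]→L[ℝ] ℝ} {y : E}
    (hη : DifferentiableAt ℝ η y) :
    lieDerivFlat X (fun z => c • η z) y = c • lieDerivFlat X η y := by
  ext v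
  have : fderiv ℝ (fun z => c • η z) y = c • fderiv ℝ η y := fderiv_fun_const_smul hη c
  simp [lieDerivFlat_apply, this, mul_add, Finset.mul_sum]

end WedgeNormed

/-! ### Symplectic bases -/

section SymplecticFamily

variable {V : Type*} [AddCommGroup V] [Module ℝ V]

/-- A nondegenerate alternating bilinear form on a space of dimension at least `2 * k` admits
`k` pairwise orthogonal hyperbolic pairs `(e i, f i)`. The induction picks a nonzero vector
orthogonal to the pairs already found, and corrects a partner of it by Gram-Schmidt. -/
theorem exists_symplectic_family [FiniteDimensional ℝ V] (B : V →ₗ[ℝ] V →ₗ[ℝ] ℝ)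
    (hB : B.IsAlt) (hnd : ∀ v, (∀ w, B v w = 0) → v = 0) (k : ℕ)
    (hk : 2 * k ≤ Module.finrank ℝ V) :
    ∃ e f : Fin k → V, (∀ i j, B (e i) (e j) = 0) ∧ (∀ i j, B (f i) (f j) = 0) ∧
      ∀ i j, B (e i) (f j) = if i = j then 1 else 0 := by
  induction k with
  | zero => exact ⟨Fin.elim0, Fin.elim0, fun i => i.elim0, fun i => i.elim0, fun i => i.elim0⟩
  | succ k ih =>
    obtain ⟨e, f, hee, hff, hef⟩ := ih (by omega)
    have hfe : ∀ i j, B (f i) (e j) = if i = j then -1 else 0 := by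
      intro i j
      rw [← hB.neg, hef]
      split_ifs with h1 h2 h2 <;> simp_all
    let T : V →ₗ[ℝ] (Fin k → ℝ) × (Fin k → ℝ) :=
      (LinearMap.pi fun i => B (e i)).prod (LinearMap.pi fun i => B (f i))
    have hker : LinearMap.ker T ≠ ⊥ := by
      apply LinearMap.ker_ne_bot_of_finrank_lt
      simp only [Module.finrank_prod, Module.finrank_fin_fun]
      omega
    obtain ⟨x, hxT, hx0⟩ := (Submodule.ne_bot_iff _).1 hker
    have hxe : ∀ i, B (e i) x = 0 := fun i => congrFun (congrArg Prod.fst hxT) i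
    have hxf : ∀ i, B (f i) x = 0 := fun i => congrFun (congrArg Prod.snd hxT) i
    have hex : ∀ i, B x (e i) = 0 := fun i => by rw [← hB.neg, hxe, neg_zero]
    have hfx : ∀ i, B x (f i) = 0 := fun i => by rw [← hB.neg, hxf, neg_zero]
    obtain ⟨z, hz⟩ : ∃ z, B x z ≠ 0 := by
      by_contra! h
      exact hx0 (hnd x h)
    let y₁ : V := (B x z)⁻¹ • z
    have hxy₁ : B x y₁ = 1 := by simp [y₁, hz]
    let y : V := y₁ + ∑ j, (B (f j) y₁ • e j - B (e j) y₁ • f j)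
    have hxy : B x y = 1 := by simp [y, hxy₁, hex, hfx]
    have hey : ∀ i, B (e i) y = 0 := fun i => by simp [y, hee, hef]
    have hfy : ∀ i, B (f i) y = 0 := fun i => by simp [y, hff, hfe]
    have hyf : ∀ i, B y (f i) = 0 := fun i => by rw [← hB.neg, hfy, neg_zero]
    refine ⟨Fin.snoc e x, Fin.snoc f y, ?_, ?_, ?_⟩
    · intro i j
      refine Fin.lastCases ?_ (fun i => ?_) i <;> refine Fin.lastCases ?_ (fun j => ?_) j <;>
        simp [hee, hxe, hex, hB.self_eq_zero]
    · intro i j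
      refine Fin.lastCases ?_ (fun i => ?_) i <;> refine Fin.lastCases ?_ (fun j => ?_) j <;>
        simp [hff, hfy, hyf, hB.self_eq_zero]
    · intro i j
      refine Fin.lastCases ?_ (fun i => ?_) i <;> refine Fin.lastCases ?_ (fun j => ?_) j <;>
        simp [hef, hey, hfx, hxy, (Fin.castSucc_lt_last _).ne, (Fin.castSucc_lt_last _).ne']

end SymplecticFamily

/-! ### The top power of a nondegenerate `2`-form -/

theorem update_pair_one {α : Type*} (v w w' : α) : Function.update ![v, w'] 1 w = ![v, w] := by
  ext i : 1
  fin_cases i <;> simp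

section TopPower

variable {V : Type*} [AddCommGroup V] [Module ℝ V] [TopologicalSpace V]

/-- The index set of `2 * N` vectors, grouped into `N` consecutive pairs. -/
def pairEquiv (N : ℕ) : Fin N × Fin 2 ≃ Fin (2 * N) :=
  finProdFinEquiv.trans (finCongr (Nat.mul_comm N 2))

theorem pairEquiv_castSucc (N : ℕ) (i : Fin N) (b : Fin 2) :
    pairEquiv (N + 1) (i.castSucc, b) = Fin.castAdd 2 (pairEquiv N (i, b)) := rfl

theorem pairEquiv_last (N : ℕ) (b : Fin 2) :
    pairEquiv (N + 1) (Fin.last N, b) = Fin.natAdd (2 * N) b := by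
  apply Fin.ext
  simp [pairEquiv, add_comm]

/-- The summand `sign σ * ∏ i, ω (v (σ (2 * i)), v (σ (2 * i + 1)))` of the permutation expansion
of `ω ∧ ⋯ ∧ ω`. -/
def pfaffianTerm (ω : V [⋀^Fin 2]→L[ℝ] ℝ) {N : ℕ} (v : Fin (2 * N) → V)
    (σ : Equiv.Perm (Fin (2 * N))) : ℝ :=
  ((Equiv.Perm.sign σ : ℤ) : ℝ) *
    ∏ i : Fin N, ω (fun b => v (σ (pairEquiv N (i, b))))

/-- The permutation expansion of a wedge power: on `2 * N` vectors it is a multiple of the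
Pfaffian of their Gram matrix under `ω`. -/
theorem wedgePow_apply (ω : V [⋀^Fin 2]→L[ℝ] ℝ) (N : ℕ) (v : Fin (2 * N) → V) :
    wedgePow ω N v = ((2 : ℝ) ^ N)⁻¹ * ∑ σ, pfaffianTerm ω v σ := by
  induction N with
  | zero =>
    have : IsEmpty (Fin (2 * 0)) := Fin.isEmpty
    rw [Fintype.sum_unique]
    simp [wedgePow, pfaffianTerm, Subsingleton.elim (default : Equiv.Perm (Fin (2 * 0))) 1]
  | succ N ih =>
    -- the permutation `τ` of the first `2 * N` indices, extended to all indices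
    let ext : Equiv.Perm (Fin (2 * N)) → Equiv.Perm (Fin (2 * N + 2)) := fun τ =>
      finSumFinEquiv.permCongr (Equiv.Perm.sumCongr τ 1)
    have ext_sign : ∀ τ, Equiv.Perm.sign (ext τ) = Equiv.Perm.sign τ := fun τ => by
      simp [ext, Equiv.Perm.sign_permCongr, Equiv.Perm.sign_sumCongr]
    have ext_cast : ∀ τ j, ext τ (Fin.castAdd 2 j) = Fin.castAdd 2 (τ j) := fun τ j => by
      simp [ext, Equiv.permCongr_apply]
    have ext_nat : ∀ τ j, ext τ (Fin.natAdd (2 * N) j) = Fin.natAdd (2 * N) j := fun τ j => by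
      simp [ext, Equiv.permCongr_apply]
    have hterm : ∀ (σ : Equiv.Perm (Fin (2 * N + 2))) (τ : Equiv.Perm (Fin (2 * N))),
        ((Equiv.Perm.sign σ : ℤ) : ℝ) *
          (pfaffianTerm ω (fun i => v (σ (Fin.castAdd 2 i))) τ *
            ω (fun j => v (σ (Fin.natAdd (2 * N) j)))) =
        pfaffianTerm (N := N + 1) ω v (σ * ext τ) := by
      intro σ τ
      simp only [pfaffianTerm, Fin.prod_univ_castSucc, pairEquiv_castSucc, pairEquiv_last]
      simp only [Nat.mul_succ, Equiv.Perm.mul_apply]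
      simp only [ext_cast, ext_nat, Equiv.Perm.sign_mul, ext_sign]
      push_cast
      ring
    have hsum : ∀ τ, ∑ σ : Equiv.Perm (Fin (2 * N + 2)),
        pfaffianTerm (N := N + 1) ω v (σ * ext τ) = ∑ σ, pfaffianTerm (N := N + 1) ω v σ :=
      fun τ => Equiv.sum_comp (Equiv.mulRight (ext τ))
        (fun σ => pfaffianTerm (N := N + 1) ω v σ)
    have h1 : wedgePow ω (N + 1) v = wedge (wedgePow ω N) ω v := rfl
    rw [h1, wedge_apply]
    simp only [ih]
    have h2 : ∀ σ : Equiv.Perm (Fin (2 * N + 2)),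
        ((Equiv.Perm.sign σ : ℤ) : ℝ) * (((2 : ℝ) ^ N)⁻¹ *
          ∑ τ, pfaffianTerm ω (fun i => v (σ (Fin.castAdd 2 i))) τ *
            ω (fun j => v (σ (Fin.natAdd (2 * N) j)))) =
        ((2 : ℝ) ^ N)⁻¹ * ∑ τ, pfaffianTerm (N := N + 1) ω v (σ * ext τ) := by
      intro σ
      rw [Finset.sum_congr rfl fun τ _ => (hterm σ τ).symm, ← Finset.mul_sum]
      ring
    simp only [mul_assoc, Finset.sum_mul, h2]
    rw [← Finset.mul_sum, Finset.sum_comm, Finset.sum_congr rfl fun τ _ => hsum τ,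
      Finset.sum_const, Finset.card_univ, Fintype.card_perm, Fintype.card_fin, nsmul_eq_mul]
    have : ((2 * N).factorial : ℝ) ≠ 0 := by positivity
    simp only [Nat.factorial_two, pow_succ]
    push_cast
    field_simp

/-- For the Gram matrix `g` of a symplectic basis, every nonzero term of the permutation expansion
equals `1`: `σ` permutes the pairs, which are moved as blocks of even size, and the reversals
inside the pairs contribute the same sign to `σ` and to the product. -/
theorem sign_mul_prod_nonneg {N : ℕ} (g : Fin N × Fin 2 → Fin N × Fin 2 → ℝ)
    (h00 : ∀ i j, g (i, 0) (j, 0) = 0) (h11 : ∀ i j, g (i, 1) (j, 1) = 0)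
    (h01 : ∀ i j, g (i, 0) (j, 1) = if i = j then 1 else 0)
    (h10 : ∀ i j, g (i, 1) (j, 0) = if i = j then -1 else 0)
    (σ : Equiv.Perm (Fin N × Fin 2)) :
    0 ≤ ((Equiv.Perm.sign σ : ℤ) : ℝ) * ∏ i, g (σ (i, 0)) (σ (i, 1)) := by
  by_cases hzero : ∏ i, g (σ (i, 0)) (σ (i, 1)) = 0
  · simp [hzero]
  have hne : ∀ i, g (σ (i, 0)) (σ (i, 1)) ≠ 0 := fun i =>
    Finset.prod_ne_zero_iff.1 hzero i (Finset.mem_univ i)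
  -- `σ (i, b) = (π i, ε i b)`, as the two entries of a pair are mapped to a common pair
  let π : Fin N → Fin N := fun i => (σ (i, 0)).1
  let ε : Fin N → Equiv.Perm (Fin 2) := fun i =>
    if (σ (i, 0)).2 = 0 then 1 else Equiv.swap 0 1
  have key : ∀ i, (∀ b, σ (i, b) = (π i, ε i b)) ∧
      g (σ (i, 0)) (σ (i, 1)) = ((Equiv.Perm.sign (ε i) : ℤ) : ℝ) := by
    intro i
    have hi := hne i
    simp only [π, ε, Fin.forall_fin_two]
    generalize σ (i, 0) = p at hi ⊢
    generalize σ (i, 1) = q at hi ⊢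
    obtain ⟨a, b⟩ := p
    obtain ⟨c, d⟩ := q
    fin_cases b <;> fin_cases d <;> by_cases hac : a = c <;>
      simp_all
  have hπ : Function.Injective π := by
    intro i j hij
    have h := (key j).1 ((ε j).symm (ε i 0))
    rw [Equiv.apply_symm_apply, ← hij, ← (key i).1 0] at h
    exact congrArg Prod.fst (σ.injective h.symm)
  let πe : Equiv.Perm (Fin N) := Equiv.ofBijective π (Finite.injective_iff_bijective.1 hπ)
  have hσ : σ = Equiv.prodCongrLeft (fun _ : Fin 2 => πe) * Equiv.prodCongrRight ε := by
    ext1 ⟨i, b⟩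
    rw [(key i).1 b]
    rfl
  have hsign : Equiv.Perm.sign σ = ∏ i, Equiv.Perm.sign (ε i) := by
    rw [hσ, Equiv.Perm.sign_mul, Equiv.Perm.sign_prodCongrLeft, Equiv.Perm.sign_prodCongrRight]
    simp
  rw [hsign, Finset.prod_congr rfl fun i _ => (key i).2]
  push_cast
  exact mul_self_nonneg _

/-- A `2`-form as a bilinear form. -/
def bilinOfForm (ω : V [⋀^Fin 2]→L[ℝ] ℝ) : V →ₗ[ℝ] V →ₗ[ℝ] ℝ :=
  LinearMap.mk₂ ℝ (fun v w => ω ![v, w])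
    (fun u v w => ω.toMultilinearMap.cons_add ![w] u v)
    (fun c v w => ω.toMultilinearMap.cons_smul ![w] c v)
    (fun v w w' => by simpa only [update_pair_one] using ω.map_update_add ![v, 0] 1 w w')
    (fun c v w => by simpa only [update_pair_one] using ω.map_update_smul ![v, 0] 1 c w)

theorem bilinOfForm_apply (ω : V [⋀^Fin 2]→L[ℝ] ℝ) (v w : V) :
    bilinOfForm ω v w = ω ![v, w] := rfl

theorem bilinOfForm_isAlt (ω : V [⋀^Fin 2]→L[ℝ] ℝ) : (bilinOfForm ω).IsAlt := fun v =>
  ω.map_eq_zero_of_eq ![v, v] (i := 0) (j := 1) rfl (by decide)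

/-- The top power of a nondegenerate `2`-form does not vanish: evaluated on a symplectic
basis, all terms of its permutation expansion are nonnegative and that of the identity is `1`. -/
theorem wedgePow_ne_zero [FiniteDimensional ℝ V] (ω : V [⋀^Fin 2]→L[ℝ] ℝ)
    (hnd : ∀ v, (∀ w, ω ![v, w] = 0) → v = 0) (N : ℕ) (hN : Module.finrank ℝ V = 2 * N) :
    wedgePow ω N ≠ 0 := by
  have halt := bilinOfForm_isAlt ω
  obtain ⟨e, f, hee, hff, hef⟩ :=
    exists_symplectic_family (bilinOfForm ω) halt hnd N hN.ge
  let w : Fin N × Fin 2 → V := fun p => ![e p.1, f p.1] p.2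
  have hfe : ∀ i j, bilinOfForm ω (f i) (e j) = if i = j then -1 else 0 := by
    intro i j
    rw [← halt.neg, hef]
    split_ifs with h1 h2 h2 <;> simp_all
  have hsum : ∑ σ, pfaffianTerm ω (w ∘ (pairEquiv N).symm) σ =
      ∑ σ : Equiv.Perm (Fin N × Fin 2), ((Equiv.Perm.sign σ : ℤ) : ℝ) *
        ∏ i, bilinOfForm ω (w (σ (i, 0))) (w (σ (i, 1))) := by
    refine (Equiv.sum_comp (pairEquiv N).permCongr _).symm.trans
      (Finset.sum_congr rfl fun σ _ => ?_)
    rw [pfaffianTerm, Equiv.Perm.sign_permCongr]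
    congr 1
    refine Finset.prod_congr rfl fun i _ => ?_
    rw [bilinOfForm_apply]
    congr 1
    ext b : 1
    fin_cases b <;> simp [Equiv.permCongr_apply]
  have hpos : 0 < ∑ σ, pfaffianTerm ω (w ∘ (pairEquiv N).symm) σ := by
    rw [hsum]
    refine Finset.sum_pos' (fun σ _ => ?_) ⟨1, Finset.mem_univ _, ?_⟩
    · exact sign_mul_prod_nonneg (fun p q => bilinOfForm ω (w p) (w q)) hee hff hef hfe σ
    · simp [w, hef]
  intro h0
  have h := wedgePow_apply ω N (w ∘ (pairEquiv N).symm)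
  rw [h0] at h
  have : (0 : ℝ) < ((2 : ℝ) ^ N)⁻¹ * ∑ σ, pfaffianTerm ω (w ∘ (pairEquiv N).symm) σ :=
    mul_pos (by positivity) hpos
  rw [← h] at this
  exact lt_irrefl _ this

end TopPower

/-! ### Hamiltonian vector fields on a normed space -/

section Flat

open Filter Topology

variable {E : Type*} [NormedAddCommGroup E] [NormedSpace ℝ E]

/-- The bilinear form of a `2`-form, depending linearly and continuously on the form. -/
def bilinL (E : Type*) [NormedAddCommGroup E] [NormedSpace ℝ E] :
    (E [⋀^Fin 2]→L[ℝ] ℝ) →L[ℝ] E →L[ℝ] E →L[ℝ] ℝ :=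
  (ContinuousLinearMap.compL ℝ E (E [⋀^Fin 1]→L[ℝ] ℝ) (E →L[ℝ] ℝ)
    (ContinuousAlternatingMap.ofSubsingletonLIE (𝕜 := ℝ) (E := E) (F := ℝ)
      (0 : Fin 1)).symm.toContinuousLinearEquiv.toContinuousLinearMap).comp
    (ContinuousAlternatingMap.curryLeftLI (𝕜 := ℝ) (E := E) (F := ℝ)
      (n := 1)).toContinuousLinearMap

theorem bilinL_apply (ω : E [⋀^Fin 2]→L[ℝ] ℝ) (v w : E) : bilinL E ω v w = ω ![v, w] := by
  change ω _ = ω _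
  congr 1
  ext i : 1
  fin_cases i <;> rfl

theorem form_pair_swap {V : Type*} [AddCommGroup V] [Module ℝ V] [TopologicalSpace V]
    (ω : V [⋀^Fin 2]→L[ℝ] ℝ) (v w : V) : ω ![v, w] = -ω ![w, v] := by
  rw [← bilinOfForm_apply, ← bilinOfForm_apply, (bilinOfForm_isAlt ω).neg]

theorem lieDerivFlat_pair (X : E → E) (ω : E → E [⋀^Fin 2]→L[ℝ] ℝ) (y v w : E) :
    lieDerivFlat X ω y ![v, w] =
      fderiv ℝ ω y (X y) ![v, w] + (ω y ![fderiv ℝ X y v, w] + ω y ![v, fderiv ℝ X y w]) := by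
  rw [lieDerivFlat_apply, Fin.sum_univ_two]
  congr 3
  · ext i : 1
    fin_cases i <;> simp
  · exact update_pair_one v _ w

theorem extDeriv_two_apply (ω : E → E [⋀^Fin 2]→L[ℝ] ℝ) (y u v w : E) :
    extDeriv ω y ![u, v, w] =
      fderiv ℝ ω y u ![v, w] - fderiv ℝ ω y v ![u, w] + fderiv ℝ ω y w ![u, v] := by
  rw [extDeriv, ContinuousAlternatingMap.alternatizeUncurryFin_apply, Fin.sum_univ_three]
  have h0 : (0 : Fin 3).removeNth ![u, v, w] = ![v, w] := by
    ext i : 1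
    fin_cases i <;> rfl
  have h1 : (1 : Fin 3).removeNth ![u, v, w] = ![u, w] := by
    ext i : 1
    fin_cases i <;> rfl
  have h2 : (2 : Fin 3).removeNth ![u, v, w] = ![u, v] := by
    ext i : 1
    fin_cases i <;> rfl
  rw [h0, h1, h2]
  simp [sub_eq_add_neg]

/-- A Hamiltonian vector field preserves the symplectic form. This is Cartan's formula
`L_X ω = ι_X dω + d (ι_X ω)` with `dω = 0` and `d (ι_X ω) = d (dH) = 0`, carried out in
coordinates. -/
theorem lieDerivFlat_eq_zero_of_hamiltonian {X : E → E} {H : E → ℝ}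
    {ω : E → E [⋀^Fin 2]→L[ℝ] ℝ} {y : E} (hω : DifferentiableAt ℝ ω y)
    (hX : DifferentiableAt ℝ X y) (hH : ContDiffAt ℝ 2 H y) (hd : extDeriv ω y = 0)
    (h : ∀ᶠ z in 𝓝 y, ∀ w, ω z ![X z, w] = fderiv ℝ H z w) :
    lieDerivFlat X ω y = 0 := by
  -- differentiating `ι_X ω = dH`
  have hB : HasFDerivAt (fun z => bilinL E (ω z) (X z)) (fderiv ℝ (fderiv ℝ H) y) y := by
    have h1 : HasFDerivAt (fderiv ℝ H) (fderiv ℝ (fderiv ℝ H) y) y :=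
      ((hH.fderiv_right (m := 1) (by norm_num)).differentiableAt one_ne_zero).hasFDerivAt
    refine h1.congr_of_eventuallyEq (h.mono fun z hz => ?_)
    ext w
    rw [bilinL_apply, hz]
  have hBω : HasFDerivAt (fun z => bilinL E (ω z)) ((bilinL E).comp (fderiv ℝ ω y)) y :=
    HasFDerivAt.comp (G := E →L[ℝ] E →L[ℝ] ℝ) (g := fun α => bilinL E α) y
      (by apply ContinuousLinearMap.hasFDerivAt) hω.hasFDerivAt
  have hB' := hBω.clm_apply hX.hasFDerivAt
  have hD : ∀ u w, fderiv ℝ (fderiv ℝ H) y u w =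
      fderiv ℝ ω y u ![X y, w] + ω y ![fderiv ℝ X y u, w] := by
    intro u w
    have h2 := congrArg (fun T : E →L[ℝ] E →L[ℝ] ℝ => T u w) (hB.unique hB')
    rw [h2]
    simp [bilinL_apply, add_comm]
  have hsymm : IsSymmSndFDerivAt ℝ H y := hH.isSymmSndFDerivAt (by simp)
  ext p
  obtain ⟨v, w, rfl⟩ : ∃ v w, p = ![v, w] := ⟨p 0, p 1, by ext i : 1; fin_cases i <;> rfl⟩
  have hclosed := extDeriv_two_apply ω y (X y) v w
  rw [hd] at hclosed
  have hvw := hsymm v w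
  rw [hD, hD] at hvw
  have hsw := form_pair_swap (ω y) v (fderiv ℝ X y w)
  rw [lieDerivFlat_pair, hsw]
  change (0 : ℝ) = _ at hclosed
  change _ = (0 : ℝ)
  linarith

theorem isInvertible_bilinL [FiniteDimensional ℝ E] (ω : E [⋀^Fin 2]→L[ℝ] ℝ)
    (hnd : ∀ v, (∀ w, ω ![v, w] = 0) → v = 0) : (bilinL E ω).IsInvertible := by
  have hinj : Function.Injective (bilinL E ω : E →ₗ[ℝ] E →L[ℝ] ℝ) := by
    rw [← LinearMap.ker_eq_bot, LinearMap.ker_eq_bot']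
    exact fun v hv => hnd v fun w => by
      rw [← bilinL_apply]
      exact congrArg (fun T : E →L[ℝ] ℝ => T w) hv
  have hrank : Module.finrank ℝ E = Module.finrank ℝ (E →L[ℝ] ℝ) := by
    rw [← LinearEquiv.finrank_eq (LinearMap.toContinuousLinearMap (𝕜 := ℝ) (E := E) (F' := ℝ))]
    exact (Subspace.dual_finrank_eq (K := ℝ) (V := E)).symm
  exact ⟨(LinearEquiv.ofInjectiveOfFinrankEq _ hinj hrank).toContinuousLinearEquiv, by ext; rfl⟩

/-- The vector field dual to a smooth covector field under a smooth nondegenerate `2`-form is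
smooth, as inversion of linear maps is smooth. -/
theorem contDiffAt_of_contract [FiniteDimensional ℝ E] {n : WithTop ℕ∞} {X : E → E}
    {θ : E → E →L[ℝ] ℝ} {ω : E → E [⋀^Fin 2]→L[ℝ] ℝ} {y : E} (hω : ContDiffAt ℝ n ω y)
    (hθ : ContDiffAt ℝ n θ y) (hnd : ∀ᶠ z in 𝓝 y, ∀ v, (∀ w, ω z ![v, w] = 0) → v = 0)
    (h : ∀ᶠ z in 𝓝 y, ∀ w, ω z ![X z, w] = θ z w) : ContDiffAt ℝ n X y := by
  have hB : ContDiffAt ℝ n (fun z => bilinL E (ω z)) y :=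
    ContDiffAt.comp (G := E →L[ℝ] E →L[ℝ] ℝ) (g := fun α => bilinL E α) y
      (by fun_prop) hω
  have hinv : ContDiffAt ℝ n (fun z => (bilinL E (ω z)).inverse) y :=
    ContDiffAt.comp (g := ContinuousLinearMap.inverse) y
      (isInvertible_bilinL _ hnd.self_of_nhds).contDiffAt_map_inverse hB
  refine (hinv.clm_apply hθ).congr_of_eventuallyEq ?_
  filter_upwards [hnd, h] with z hz hXz
  have : θ z = bilinL E (ω z) (X z) := by
    ext w
    rw [bilinL_apply, hXz]
  rw [this, (isInvertible_bilinL _ hz).inverse_apply_self]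

/-! ### Pullback along a flow on a normed space -/

/-- The pullback of a form `η` along a flow `F` of `X` evolves by the pullback of `L_X η`. The
spatial derivative of the flow satisfies the linearised equation because mixed second
derivatives of `F` commute. -/
theorem hasDerivAt_pullback_flow {E' : Type*} [NormedAddCommGroup E'] [NormedSpace ℝ E']
    {k : ℕ} {F : ℝ × E' → E} {X : E → E} {η : E → E [⋀^Fin k]→L[ℝ] ℝ} {t₀ : ℝ} {z₀ : E'}
    (hF : ContDiffAt ℝ 2 F (t₀, z₀)) (hX : DifferentiableAt ℝ X (F (t₀, z₀)))
    (hη : DifferentiableAt ℝ η (F (t₀, z₀)))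
    (hflow : ∀ᶠ p in 𝓝 (t₀, z₀), fderiv ℝ F p (1, 0) = X (F p)) :
    HasDerivAt (fun t => (η (F (t, z₀))).compContinuousLinearMap
        ((fderiv ℝ F (t, z₀)).comp (ContinuousLinearMap.inr ℝ ℝ E')))
      ((lieDerivFlat X η (F (t₀, z₀))).compContinuousLinearMap
        ((fderiv ℝ F (t₀, z₀)).comp (ContinuousLinearMap.inr ℝ ℝ E'))) t₀ := by
  have hF1 : HasFDerivAt F (fderiv ℝ F (t₀, z₀)) (t₀, z₀) :=
    (hF.differentiableAt two_ne_zero).hasFDerivAt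
  have hF2 : HasFDerivAt (fderiv ℝ F) (fderiv ℝ (fderiv ℝ F) (t₀, z₀)) (t₀, z₀) :=
    ((hF.fderiv_right (m := 1) (by norm_num)).differentiableAt one_ne_zero).hasFDerivAt
  have hline : HasDerivAt (fun t : ℝ => (t, z₀)) ((1 : ℝ), (0 : E')) t₀ :=
    (hasDerivAt_id t₀).prodMk (hasDerivAt_const t₀ z₀)
  have hFt : HasDerivAt (fun t => F (t, z₀)) (X (F (t₀, z₀))) t₀ := by
    have h := hF1.comp_hasDerivAt t₀ hline
    rwa [hflow.self_of_nhds] at h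
  -- the linearised flow equation
  have hlin : ∀ w, fderiv ℝ (fderiv ℝ F) (t₀, z₀) (1, 0) w =
      fderiv ℝ X (F (t₀, z₀)) (fderiv ℝ F (t₀, z₀) w) := by
    intro w
    rw [(hF.isSymmSndFDerivAt (by simp)) (1, 0) w]
    have h1 : HasFDerivAt (fun p => fderiv ℝ F p (1, 0))
        ((ContinuousLinearMap.apply ℝ E ((1 : ℝ), (0 : E'))).comp
          (fderiv ℝ (fderiv ℝ F) (t₀, z₀))) (t₀, z₀) :=
      (ContinuousLinearMap.apply ℝ E ((1 : ℝ), (0 : E'))).hasFDerivAt.comp (t₀, z₀) hF2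
    have h2 := (hX.hasFDerivAt.comp (t₀, z₀) hF1).congr_of_eventuallyEq hflow
    have h3 := congrArg (fun T : ℝ × E' →L[ℝ] E => T w) (h1.unique h2)
    simpa using h3
  have hL : HasDerivAt
      (fun t => (fderiv ℝ F (t, z₀)).comp (ContinuousLinearMap.inr ℝ ℝ E'))
      ((fderiv ℝ X (F (t₀, z₀))).comp
        ((fderiv ℝ F (t₀, z₀)).comp (ContinuousLinearMap.inr ℝ ℝ E'))) t₀ := by
    have h1 : HasDerivAt (fun t => fderiv ℝ F (t, z₀))
        (fderiv ℝ (fderiv ℝ F) (t₀, z₀) (1, 0)) t₀ := hF2.comp_hasDerivAt t₀ hline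
    have h := h1.clm_comp (hasDerivAt_const t₀ (ContinuousLinearMap.inr ℝ ℝ E'))
    convert h using 1
    ext w
    simp [hlin]
  have hηt : HasDerivAt (fun t => η (F (t, z₀)))
      (fderiv ℝ η (F (t₀, z₀)) (X (F (t₀, z₀)))) t₀ :=
    HasFDerivAt.comp_hasDerivAt (l := η) t₀ hη.hasFDerivAt hFt
  have h := (hηt.hasFDerivAt.continuousAlternatingMapCompContinuousLinearMap
    hL.hasFDerivAt).hasDerivAt
  convert h using 1
  ext v
  simp only [ContinuousAlternatingMap.compContinuousLinearMap_apply, lieDerivFlat,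
    ContinuousAlternatingMap.add_apply,
    ContinuousAlternatingMap.fderivCompContinuousLinearMap_apply, add_apply,
    ContinuousLinearMap.comp_apply, ContinuousLinearMap.toSpanSingleton_apply, one_smul,
    ContinuousAlternatingMap.compContinuousLinearMapCLM_apply, Function.comp_def]
  congr 1
  refine Finset.sum_congr rfl fun i _ => ?_
  congr 1
  ext j : 1
  by_cases hj : j = i
  · subst hj; simp
  · simp [hj]

end Flat

/-! ### Forms and vector fields in a chart -/

section Charts

open Filter Topology Bundle

variable {n : ℕ} {M : Type*} [TopologicalSpace M] [ChartedSpace (Rn n) M]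

theorem extChartAt_target_mem_nhds_of_mem {x₀ : M} {y : Rn n}
    (hy : y ∈ (extChartAt (𝓡 n) x₀).target) : (extChartAt (𝓡 n) x₀).target ∈ 𝓝 y :=
  (isOpen_extChartAt_target x₀).mem_nhds hy

theorem formInChart_apply {k : ℕ} (η : DForm n M k) (x₀ : M) (y : Rn n) (v : Fin k → Rn n) :
    formInChart η x₀ y v =
      η ((extChartAt (𝓡 n) x₀).symm y) (fun i => chartSymmD x₀ y (v i)) := rfl

theorem form_pair_comp {V W : Type*} [AddCommGroup V] [Module ℝ V] [TopologicalSpace V]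
    [AddCommGroup W] [Module ℝ W] [TopologicalSpace W] (ω : V [⋀^Fin 2]→L[ℝ] ℝ)
    (f : W →L[ℝ] V) (v w : W) : ω.compContinuousLinearMap f ![v, w] = ω ![f v, f w] := by
  change ω _ = ω _
  congr 1
  ext i : 1
  fin_cases i <;> rfl

theorem vfieldInChart_extChartAt (X : VField n M) {x₀ x : M}
    (hx : x ∈ (extChartAt (𝓡 n) x₀).source) :
    vfieldInChart X x₀ (extChartAt (𝓡 n) x₀ x) = chartD x₀ x (X x) := by
  rw [vfieldInChart, (extChartAt (𝓡 n) x₀).left_inv hx]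

theorem IsSmoothForm.contDiffAt {k : ℕ} {η : DForm n M k} (hη : IsSmoothForm η) {x₀ : M}
    {y : Rn n} (hy : y ∈ (extChartAt (𝓡 n) x₀).target) :
    ContDiffAt ℝ (⊤ : ℕ∞) (formInChart η x₀) y :=
  (hη x₀).contDiffAt (extChartAt_target_mem_nhds_of_mem hy)

variable [IsManifold (𝓡 n) (⊤ : ℕ∞) M]

theorem chartD_self (x : M) : chartD (n := n) x x = ContinuousLinearMap.id ℝ (Rn n) :=
  mfderiv_extChartAt_self

theorem hasMFDerivAt_extChartAt {x₀ x : M} (hx : x ∈ (extChartAt (𝓡 n) x₀).source) :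
    HasMFDerivAt (𝓡 n) 𝓘(ℝ, Rn n) (extChartAt (𝓡 n) x₀) x (chartD x₀ x) :=
  (mdifferentiableAt_extChartAt (by rwa [extChartAt_source] at hx)).hasMFDerivAt

theorem hasMFDerivAt_extChartAt_symm {x₀ : M} {y : Rn n}
    (hy : y ∈ (extChartAt (𝓡 n) x₀).target) :
    HasMFDerivAt 𝓘(ℝ, Rn n) (𝓡 n) (extChartAt (𝓡 n) x₀).symm y (chartSymmD x₀ y) := by
  have h := mdifferentiableWithinAt_extChartAt_symm (I := 𝓡 n) hy
  rw [ModelWithCorners.range_eq_univ, mdifferentiableWithinAt_univ] at h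
  exact h.hasMFDerivAt

theorem chartD_chartSymmD {x₀ : M} {y : Rn n} (hy : y ∈ (extChartAt (𝓡 n) x₀).target)
    (v : Rn n) : chartD x₀ ((extChartAt (𝓡 n) x₀).symm y) (chartSymmD x₀ y v) = v := by
  have h := mfderiv_extChartAt_comp_mfderivWithin_extChartAt_symm (I := 𝓡 n) hy
  rw [ModelWithCorners.range_eq_univ, mfderivWithin_univ] at h
  exact ContinuousLinearMap.ext_iff.1 h v

theorem chartSymmD_chartD {x₀ : M} {y : Rn n} (hy : y ∈ (extChartAt (𝓡 n) x₀).target)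
    (v : TangentSpace (𝓡 n) ((extChartAt (𝓡 n) x₀).symm y)) :
    chartSymmD x₀ y (chartD x₀ ((extChartAt (𝓡 n) x₀).symm y) v) = v := by
  have h := mfderivWithin_extChartAt_symm_comp_mfderiv_extChartAt (I := 𝓡 n) hy
  rw [ModelWithCorners.range_eq_univ, mfderivWithin_univ] at h
  exact ContinuousLinearMap.ext_iff.1 h v

theorem formInChart_chartD {k : ℕ} (η : DForm n M k) {x₀ x : M}
    (hx : x ∈ (extChartAt (𝓡 n) x₀).source) (v : Fin k → TangentSpace (𝓡 n) x) :
    formInChart η x₀ (extChartAt (𝓡 n) x₀ x) (fun i => chartD x₀ x (v i)) = η x v := by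
  obtain ⟨y, hy, rfl⟩ : ∃ y ∈ (extChartAt (𝓡 n) x₀).target,
      (extChartAt (𝓡 n) x₀).symm y = x :=
    ⟨_, (extChartAt (𝓡 n) x₀).map_source hx, (extChartAt (𝓡 n) x₀).left_inv hx⟩
  rw [(extChartAt (𝓡 n) x₀).right_inv hy, formInChart_apply]
  simp only [chartSymmD_chartD hy]

theorem lieDeriv_apply {k : ℕ} (X : VField n M) (η : DForm n M k) (x : M) :
    lieDeriv X η x =
      lieDerivFlat (vfieldInChart X x) (formInChart η x) (extChartAt (𝓡 n) x x) := by
  rw [lieDeriv, chartD_self]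
  rfl

theorem extDerivM_apply {k : ℕ} (η : DForm n M k) (x : M) :
    extDerivM η x = extDeriv (formInChart η x) (extChartAt (𝓡 n) x x) := by
  rw [extDerivM, chartD_self]
  rfl

/-- A vector field that is smooth in the preferred chart at each point is smooth. -/
theorem isSmoothVField_of_contDiffAt {X : VField n M}
    (h : ∀ x : M, ContDiffAt ℝ (⊤ : ℕ∞) (vfieldInChart X x) (extChartAt (𝓡 n) x x)) :
    IsSmoothVField X := by
  intro x₀
  refine (contMDiffAt_section x₀).2 ?_
  have h1 : ContMDiffAt (𝓡 n) 𝓘(ℝ, Rn n) (⊤ : ℕ∞)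
      (vfieldInChart X x₀ ∘ extChartAt (𝓡 n) x₀) x₀ :=
    (h x₀).contMDiffAt.comp x₀ contMDiffAt_extChartAt
  refine h1.congr_of_eventuallyEq ?_
  filter_upwards [extChartAt_source_mem_nhds (I := 𝓡 n) x₀] with x hx
  rw [Function.comp_apply, vfieldInChart_extChartAt X hx]
  have hx' : x ∈ (chartAt (Rn n) x₀).source := by rwa [extChartAt_source] at hx
  have hbase : x ∈ (trivializationAt (Rn n) (TangentSpace (𝓡 n)) x₀).baseSet := by
    rwa [TangentBundle.trivializationAt_baseSet]
  have h2 := ContinuousLinearMap.ext_iff.1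
    (TangentBundle.continuousLinearMapAt_trivializationAt (I := 𝓡 n) hx') (X x)
  rw [Trivialization.continuousLinearMapAt_apply,
    Trivialization.coe_linearMapAt_of_mem _ hbase] at h2
  exact h2

end Charts

/-! ### Hamiltonian vector fields in a chart -/

section Hamiltonian

open Filter Topology

variable {n : ℕ} {M : Type*} [TopologicalSpace M] [ChartedSpace (Rn n) M]
  [IsManifold (𝓡 n) (⊤ : ℕ∞) M] (ω : SymplecticForm n M) {H : M → ℝ}

theorem formInChart_nondegenerate {x₀ : M} {y : Rn n}
    (hy : y ∈ (extChartAt (𝓡 n) x₀).target) (v : Rn n)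
    (hv : ∀ w, formInChart ω.toForm x₀ y ![v, w] = 0) : v = 0 := by
  have h : chartSymmD x₀ y v = 0 := by
    refine ω.nondegenerate _ _ fun w => ?_
    have h1 := hv (chartD x₀ _ w)
    rw [formInChart, form_pair_comp, chartSymmD_chartD hy] at h1
    exact h1
  rw [← chartD_chartSymmD hy v, h, map_zero]

theorem contDiffAt_comp_extChartAt_symm (hH : ContMDiff (𝓡 n) 𝓘(ℝ, ℝ) (⊤ : ℕ∞) H) {x₀ : M}
    {y : Rn n} (hy : y ∈ (extChartAt (𝓡 n) x₀).target) :
    ContDiffAt ℝ (⊤ : ℕ∞) (H ∘ (extChartAt (𝓡 n) x₀).symm) y := by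
  have h : ContMDiffAt 𝓘(ℝ, Rn n) (𝓡 n) (⊤ : ℕ∞) (extChartAt (𝓡 n) x₀).symm y :=
    (contMDiffOn_extChartAt_symm x₀).contMDiffAt (extChartAt_target_mem_nhds_of_mem hy)
  exact ((hH _).comp y h).contDiffAt

/-- The defining relation `ι_X ω = dH` read in a chart. -/
theorem formInChart_hamiltonianVField (hH : ContMDiff (𝓡 n) 𝓘(ℝ, ℝ) (⊤ : ℕ∞) H) {x₀ : M}
    {y : Rn n} (hy : y ∈ (extChartAt (𝓡 n) x₀).target) (w : Rn n) :
    formInChart ω.toForm x₀ y ![vfieldInChart (hamiltonianVField ω H) x₀ y, w] =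
      fderiv ℝ (H ∘ (extChartAt (𝓡 n) x₀).symm) y w := by
  have h1 : HasMFDerivAt (𝓡 n) 𝓘(ℝ, ℝ) H ((extChartAt (𝓡 n) x₀).symm y)
      (differential H ((extChartAt (𝓡 n) x₀).symm y)) :=
    ((hH _).mdifferentiableAt (by simp)).hasMFDerivAt
  have h2 : HasFDerivAt (H ∘ (extChartAt (𝓡 n) x₀).symm)
      ((differential H ((extChartAt (𝓡 n) x₀).symm y)).comp (chartSymmD x₀ y) : Rn n →L[ℝ] ℝ) y :=
    (h1.comp y (hasMFDerivAt_extChartAt_symm hy)).hasFDerivAt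
  rw [h2.fderiv, formInChart, form_pair_comp, vfieldInChart, chartSymmD_chartD hy]
  exact hamiltonianVField_spec ω H _ _

theorem contDiffAt_hamiltonianVField (hH : ContMDiff (𝓡 n) 𝓘(ℝ, ℝ) (⊤ : ℕ∞) H) {x₀ : M}
    {y : Rn n} (hy : y ∈ (extChartAt (𝓡 n) x₀).target) :
    ContDiffAt ℝ (⊤ : ℕ∞) (vfieldInChart (hamiltonianVField ω H) x₀) y := by
  have hnear := extChartAt_target_mem_nhds_of_mem hy
  refine contDiffAt_of_contract (ω.smooth.contDiffAt hy)
    (θ := fderiv ℝ (H ∘ (extChartAt (𝓡 n) x₀).symm))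
    ((contDiffAt_comp_extChartAt_symm hH hy).fderiv_right (by simp)) ?_ ?_
  · filter_upwards [hnear] with z hz using formInChart_nondegenerate ω hz
  · filter_upwards [hnear] with z hz using formInChart_hamiltonianVField ω hH hz

theorem isSmoothVField_hamiltonianVField (hH : ContMDiff (𝓡 n) 𝓘(ℝ, ℝ) (⊤ : ℕ∞) H) :
    IsSmoothVField (hamiltonianVField ω H) :=
  isSmoothVField_of_contDiffAt fun x =>
    contDiffAt_hamiltonianVField ω hH (mem_extChartAt_target x)

theorem lieDerivFlat_hamiltonianVField (hH : ContMDiff (𝓡 n) 𝓘(ℝ, ℝ) (⊤ : ℕ∞) H) (x : M) :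
    lieDerivFlat (vfieldInChart (hamiltonianVField ω H) x) (formInChart ω.toForm x)
      (extChartAt (𝓡 n) x x) = 0 := by
  have hx := mem_extChartAt_target (I := 𝓡 n) x
  have htop : ((⊤ : ℕ∞) : WithTop ℕ∞) ≠ 0 := by simp
  refine lieDerivFlat_eq_zero_of_hamiltonian ((ω.smooth.contDiffAt hx).differentiableAt htop)
    ((contDiffAt_hamiltonianVField ω hH hx).differentiableAt htop)
    ((contDiffAt_comp_extChartAt_symm hH hx).of_le ENat.LEInfty.out) ?_ ?_
  · rw [← extDerivM_apply, ω.closed]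
    rfl
  · filter_upwards [extChartAt_target_mem_nhds_of_mem hx] with z hz
      using formInChart_hamiltonianVField ω hH hz

end Hamiltonian

/-! ### The Liouville form and the divergence -/

section Liouville

variable {N : ℕ} {M : Type*} [TopologicalSpace M] [ChartedSpace (Rn (2 * N)) M]
  (ω : SymplecticForm (2 * N) M)

theorem formInChart_liouvilleForm (x₀ : M) :
    formInChart (liouvilleForm ω) x₀ =
      fun y => (N.factorial : ℝ)⁻¹ • wedgePow (formInChart ω.toForm x₀ y) N := by
  ext1 y
  unfold formInChart liouvilleForm
  rw [← wedgePow_compContinuousLinearMap]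
  rfl

theorem isSmoothForm_liouvilleForm : IsSmoothForm (liouvilleForm ω) := by
  intro x₀
  rw [formInChart_liouvilleForm]
  exact ((contDiff_wedgePow _ N).comp_contDiffOn (ω.smooth x₀)).const_smul _

theorem liouvilleForm_ne_zero (x : M) : liouvilleForm ω x ≠ 0 := by
  have : FiniteDimensional ℝ (TangentSpace (𝓡 (2 * N)) x) :=
    inferInstanceAs (FiniteDimensional ℝ (Rn (2 * N)))
  have hrank : Module.finrank ℝ (TangentSpace (𝓡 (2 * N)) x) = 2 * N :=
    finrank_euclideanSpace_fin (𝕜 := ℝ) (n := 2 * N)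
  exact smul_ne_zero (by positivity) (wedgePow_ne_zero _ (ω.nondegenerate x) N hrank)

theorem lieDeriv_liouvilleForm [IsManifold (𝓡 (2 * N)) (⊤ : ℕ∞) M] {H : M → ℝ}
    (hH : ContMDiff (𝓡 (2 * N)) 𝓘(ℝ, ℝ) (⊤ : ℕ∞) H) :
    lieDeriv (hamiltonianVField ω H) (liouvilleForm ω) = 0 := by
  ext1 x
  have hω : DifferentiableAt ℝ (formInChart ω.toForm x) (extChartAt (𝓡 (2 * N)) x x) :=
    (ω.smooth.contDiffAt (mem_extChartAt_target x)).differentiableAt (by simp)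
  have hpow : DifferentiableAt ℝ (fun y => wedgePow (formInChart ω.toForm x y) N)
      (extChartAt (𝓡 (2 * N)) x x) :=
    ((contDiff_wedgePow 1 N).differentiable one_ne_zero _).comp _ hω
  rw [lieDeriv_apply, formInChart_liouvilleForm, lieDerivFlat_const_smul _ _ hpow,
    lieDerivFlat_wedgePow_eq_zero _ hω (lieDerivFlat_hamiltonianVField ω hH x) N, smul_zero]
  rfl

/-- Forms of top degree are multiples of a nonzero form of top degree. -/
theorem existsUnique_eq_smul_of_finrank {V : Type*} [AddCommGroup V] [Module ℝ V]
    [TopologicalSpace V] [FiniteDimensional ℝ V] {n : ℕ} (hn : Module.finrank ℝ V = n)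
    {Ω : V [⋀^Fin n]→L[ℝ] ℝ} (hΩ : Ω ≠ 0) (η : V [⋀^Fin n]→L[ℝ] ℝ) :
    ∃! c : ℝ, η = c • Ω := by
  let e := Module.finBasisOfFinrankEq ℝ V hn
  have hdet : ∀ (α : V [⋀^Fin n]→L[ℝ] ℝ) v, α v = α e * e.det v := fun α v =>
    congrArg (fun f : V [⋀^Fin n]→ₗ[ℝ] ℝ => f v) (α.toAlternatingMap.eq_smul_basis_det e)
  have hΩe : Ω e ≠ 0 := by
    intro h
    apply hΩ
    ext v
    rw [hdet, h, zero_mul]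
    rfl
  refine ⟨η e / Ω e, ?_, fun c hc => ?_⟩
  · ext v
    rw [ContinuousAlternatingMap.smul_apply, smul_eq_mul, hdet η v, hdet Ω v, ← mul_assoc,
      div_mul_cancel₀ _ hΩe]
  · rw [hc, ContinuousAlternatingMap.smul_apply, smul_eq_mul, mul_div_cancel_right₀ _ hΩe]

/-- The divergence with respect to a volume form is characterised by its defining relation. -/
theorem lieDeriv_eq_smul_iff_eq_divergence {n : ℕ} {M : Type*} [TopologicalSpace M]
    [ChartedSpace (Rn n) M] {Ω : DForm n M n} (hΩ : ∀ x, Ω x ≠ 0) (X : VField n M) (f : M → ℝ) :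
    (∀ x, lieDeriv X Ω x = f x • Ω x) ↔ f = divergence Ω X := by
  have hex : ∀ x, ∃! c : ℝ, lieDeriv X Ω x = c • Ω x := by
    intro x
    have : FiniteDimensional ℝ (TangentSpace (𝓡 n) x) :=
      inferInstanceAs (FiniteDimensional ℝ (Rn n))
    have hrank : Module.finrank ℝ (TangentSpace (𝓡 n) x) = n :=
      finrank_euclideanSpace_fin (𝕜 := ℝ) (n := n)
    exact existsUnique_eq_smul_of_finrank hrank (hΩ x) _
  have hdiv : ∀ x, lieDeriv X Ω x = divergence Ω X x • Ω x := fun x =>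
    Classical.epsilon_spec (hex x).exists
  constructor
  · intro h
    ext x
    exact (hex x).unique (h x) (hdiv x)
  · rintro rfl
    exact hdiv

theorem lieDeriv_eq_zero_iff_divergence_eq_zero {n : ℕ} {M : Type*} [TopologicalSpace M]
    [ChartedSpace (Rn n) M] {Ω : DForm n M n} (hΩ : ∀ x, Ω x ≠ 0) (X : VField n M) :
    lieDeriv X Ω = 0 ↔ divergence Ω X = 0 := by
  rw [eq_comm (a := divergence Ω X), ← lieDeriv_eq_smul_iff_eq_divergence hΩ, funext_iff]
  simp

end Liouville

/-! ### Pullback along a local flow -/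

section Flow

open Filter Topology

variable {n : ℕ} {M : Type*} [TopologicalSpace M] [ChartedSpace (Rn n) M]

theorem pullbackForm_eq_of_eventuallyEq_id {k : ℕ} {f : M → M} (η : DForm n M k) {x : M}
    (hf : f =ᶠ[𝓝 x] id) : pullbackForm f η x = η x := by
  have h1 : HasMFDerivAt (𝓡 n) (𝓡 n) f x
      (ContinuousLinearMap.id ℝ (TangentSpace (𝓡 n) x)) :=
    (hasMFDerivAt_id x).congr_of_eventuallyEq hf
  have h2 := h1.mfderiv
  have hfx : f x = x := hf.self_of_nhds
  ext v
  change η (f x) (fun i => mfderiv (𝓡 n) (𝓡 n) f x (v i)) = η x v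
  rw [h2]
  -- all tangent spaces are the model space, so that `η` can be evaluated across base points
  have h3 : ∀ z, z = x → (η z : Rn n [⋀^Fin k]→L[ℝ] ℝ) v = η x v := by
    rintro z rfl
    rfl
  exact h3 _ hfx

variable {X : VField n M} {U : Set (ℝ × M)} {Φ : ℝ → M → M}

theorem IsLocalFlow.contMDiffAt (hΦ : IsLocalFlow X U Φ) {p : ℝ × M} (hp : p ∈ U) :
    ContMDiffAt (𝓘(ℝ, ℝ).prod (𝓡 n)) (𝓡 n) (⊤ : ℕ∞) (fun p : ℝ × M => Φ p.1 p.2) p :=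
  hΦ.smooth.contMDiffAt (hΦ.isOpen.mem_nhds hp)

theorem IsLocalFlow.isOpen_times (hΦ : IsLocalFlow X U Φ) (x : M) :
    IsOpen {t : ℝ | (t, x) ∈ U} :=
  hΦ.isOpen.preimage (by fun_prop : Continuous fun t : ℝ => (t, x))

theorem IsLocalFlow.hasMFDerivAt (hΦ : IsLocalFlow X U Φ) {t : ℝ} {x : M} (h : (t, x) ∈ U) :
    HasMFDerivAt (𝓡 n) (𝓡 n) (Φ t) x (mfderiv (𝓡 n) (𝓡 n) (Φ t) x) := by
  have h1 : ContMDiffAt (𝓡 n) (𝓘(ℝ, ℝ).prod (𝓡 n)) (⊤ : ℕ∞) (fun z : M => (t, z)) x :=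
    contMDiffAt_const.prodMk contMDiffAt_id
  have h2 : ContMDiffAt (𝓡 n) (𝓡 n) (⊤ : ℕ∞) (Φ t) x :=
    ContMDiffAt.comp (g := fun p : ℝ × M => Φ p.1 p.2) x (hΦ.contMDiffAt h) h1
  exact (h2.mdifferentiableAt (by simp)).hasMFDerivAt

variable [IsManifold (𝓡 n) (⊤ : ℕ∞) M]

/-- A local flow read in the chart at `x` on the source and in the chart at `y` on the
target. -/
def flowInChart (Φ : ℝ → M → M) (x y : M) (p : ℝ × Rn n) : Rn n :=
  extChartAt (𝓡 n) y (Φ p.1 ((extChartAt (𝓡 n) x).symm p.2))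

theorem IsLocalFlow.contDiffAt_flowInChart (hΦ : IsLocalFlow X U Φ) {t : ℝ} {x y : M}
    (h : (t, x) ∈ U) (hy : Φ t x ∈ (extChartAt (𝓡 n) y).source) :
    ContDiffAt ℝ (⊤ : ℕ∞) (flowInChart (n := n) Φ x y) (t, extChartAt (𝓡 n) x x) := by
  have hx : (extChartAt (𝓡 n) x).symm (extChartAt (𝓡 n) x x) = x := extChartAt_to_inv x
  have h1 : ContMDiffAt 𝓘(ℝ, ℝ × Rn n) (𝓘(ℝ, ℝ).prod (𝓡 n)) (⊤ : ℕ∞)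
      (fun p : ℝ × Rn n => (p.1, (extChartAt (𝓡 n) x).symm p.2)) (t, extChartAt (𝓡 n) x x) := by
    refine ContMDiffAt.prodMk contDiff_fst.contMDiff.contMDiffAt ?_
    have h2 : ContMDiffAt 𝓘(ℝ, Rn n) (𝓡 n) (⊤ : ℕ∞) (extChartAt (𝓡 n) x).symm
        (extChartAt (𝓡 n) x x) :=
      (contMDiffOn_extChartAt_symm x).contMDiffAt (extChartAt_target_mem_nhds x)
    exact h2.comp (t, extChartAt (𝓡 n) x x) contDiff_snd.contMDiff.contMDiffAt
  have h2 : ContMDiffAt (𝓘(ℝ, ℝ).prod (𝓡 n)) (𝓡 n) (⊤ : ℕ∞) (fun p : ℝ × M => Φ p.1 p.2)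
      (t, (extChartAt (𝓡 n) x).symm (extChartAt (𝓡 n) x x)) := by
    rw [hx]
    exact hΦ.contMDiffAt h
  have h3 : ContMDiffAt (𝓡 n) 𝓘(ℝ, Rn n) (⊤ : ℕ∞) (extChartAt (𝓡 n) y)
      (Φ t ((extChartAt (𝓡 n) x).symm (extChartAt (𝓡 n) x x))) := by
    rw [hx]
    exact contMDiffAt_extChartAt' (by rwa [extChartAt_source] at hy)
  exact (h3.comp (t, extChartAt (𝓡 n) x x)
    (h2.comp (t, extChartAt (𝓡 n) x x) h1)).contDiffAt

/-- The flow equation in charts. -/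
theorem IsLocalFlow.hasDerivAt_flowInChart (hΦ : IsLocalFlow X U Φ) {x y : M} {p : ℝ × Rn n}
    (hp : (p.1, (extChartAt (𝓡 n) x).symm p.2) ∈ U)
    (hy : Φ p.1 ((extChartAt (𝓡 n) x).symm p.2) ∈ (extChartAt (𝓡 n) y).source) :
    HasDerivAt (fun t => flowInChart (n := n) Φ x y (t, p.2))
      (vfieldInChart X y (flowInChart Φ x y p)) p.1 := by
  have h1 : HasMFDerivAt 𝓘(ℝ, ℝ) (𝓡 n) (fun t => Φ t ((extChartAt (𝓡 n) x).symm p.2)) p.1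
      ((1 : ℝ →L[ℝ] ℝ).smulRight (X (Φ p.1 ((extChartAt (𝓡 n) x).symm p.2)))) :=
    (hΦ.integralCurve _ p.1 hp).hasMFDerivAt ((hΦ.isOpen_times _).mem_nhds hp)
  have h2 : HasFDerivAt (fun t => flowInChart (n := n) Φ x y (t, p.2))
      ((chartD y (Φ p.1 ((extChartAt (𝓡 n) x).symm p.2))).comp
        ((1 : ℝ →L[ℝ] ℝ).smulRight (X (Φ p.1 ((extChartAt (𝓡 n) x).symm p.2)))) :
          ℝ →L[ℝ] Rn n) p.1 :=
    ((hasMFDerivAt_extChartAt hy).comp p.1 h1).hasFDerivAt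
  have h3 := h2.hasDerivAt
  rw [flowInChart, vfieldInChart_extChartAt X hy]
  convert! h3 using 1
  change _ = chartD y _ ((1 : ℝ) • X _)
  rw [one_smul]

/-- The spatial derivative of a flow in charts. -/
theorem IsLocalFlow.fderiv_flowInChart_inr (hΦ : IsLocalFlow X U Φ) {t : ℝ} {x y : M}
    (h : (t, x) ∈ U) (hy : Φ t x ∈ (extChartAt (𝓡 n) y).source) (w : Rn n) :
    fderiv ℝ (flowInChart (n := n) Φ x y) (t, extChartAt (𝓡 n) x x) (0, w) =
      chartD y (Φ t x) (mfderiv (𝓡 n) (𝓡 n) (Φ t) x w) := by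
  have hx : (extChartAt (𝓡 n) x).symm (extChartAt (𝓡 n) x x) = x := extChartAt_to_inv x
  have h1 : HasMFDerivAt 𝓘(ℝ, Rn n) (𝓡 n) (extChartAt (𝓡 n) x).symm (extChartAt (𝓡 n) x x)
      (ContinuousLinearMap.id ℝ (Rn n)) := by
    have h2 := hasMFDerivAt_extChartAt_symm (n := n) (mem_extChartAt_target x)
    have h3 := mfderivWithin_range_extChartAt_symm (I := 𝓡 n) (x := x)
    rw [ModelWithCorners.range_eq_univ, mfderivWithin_univ] at h3
    rw [chartSymmD, h3] at h2
    exact h2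
  have h4 : HasMFDerivAt (𝓡 n) 𝓘(ℝ, Rn n) (extChartAt (𝓡 n) y ∘ Φ t) x
      ((chartD y (Φ t x)).comp (mfderiv (𝓡 n) (𝓡 n) (Φ t) x)) :=
    (hasMFDerivAt_extChartAt hy).comp x (hΦ.hasMFDerivAt h)
  have h5 : HasFDerivAt (fun z => flowInChart (n := n) Φ x y (t, z))
      ((chartD y (Φ t x)).comp (mfderiv (𝓡 n) (𝓡 n) (Φ t) x) : Rn n →L[ℝ] Rn n)
      (extChartAt (𝓡 n) x x) := by
    rw [← hx] at h4
    have h7 := (h4.comp _ h1).hasFDerivAt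
    rw [hx] at h7
    exact h7
  have h6 : HasFDerivAt (fun z => flowInChart (n := n) Φ x y (t, z))
      ((fderiv ℝ (flowInChart (n := n) Φ x y) (t, extChartAt (𝓡 n) x x)).comp
        (ContinuousLinearMap.inr ℝ ℝ (Rn n))) (extChartAt (𝓡 n) x x) :=
    (((hΦ.contDiffAt_flowInChart h hy).differentiableAt (by simp)).hasFDerivAt).comp
      (extChartAt (𝓡 n) x x) (hasFDerivAt_prodMk_right t _)
  exact ContinuousLinearMap.ext_iff.1 (h6.unique h5) w

theorem IsLocalFlow.pullbackForm_apply_eq (hΦ : IsLocalFlow X U Φ) {k : ℕ} (η : DForm n M k)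
    {t : ℝ} {x y : M} (h : (t, x) ∈ U) (hy : Φ t x ∈ (extChartAt (𝓡 n) y).source)
    (v : Fin k → Rn n) :
    pullbackForm (Φ t) η x v =
      (formInChart η y (flowInChart Φ x y (t, extChartAt (𝓡 n) x x))).compContinuousLinearMap
        ((fderiv ℝ (flowInChart (n := n) Φ x y) (t, extChartAt (𝓡 n) x x)).comp
          (ContinuousLinearMap.inr ℝ ℝ (Rn n))) v := by
  have hF : flowInChart (n := n) Φ x y (t, extChartAt (𝓡 n) x x) =
      extChartAt (𝓡 n) y (Φ t x) := by
    simp only [flowInChart, extChartAt_to_inv]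
  rw [hF, ContinuousAlternatingMap.compContinuousLinearMap_apply]
  refine (formInChart_chartD η hy (fun i => mfderiv (𝓡 n) (𝓡 n) (Φ t) x (v i))).symm.trans ?_
  congr 1
  ext1 i
  exact (hΦ.fderiv_flowInChart_inr h hy (v i)).symm

/-- Along a local flow of `X`, the pullback of a form `η` with `L_X η = 0` is stationary. -/
theorem IsLocalFlow.hasDerivAt_pullbackForm (hΦ : IsLocalFlow X U Φ)
    (hX : ∀ x, DifferentiableAt ℝ (vfieldInChart X x) (extChartAt (𝓡 n) x x)) {k : ℕ}
    {η : DForm n M k} (hη : IsSmoothForm η) (hL : lieDeriv X η = 0) {t₀ : ℝ} {x : M}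
    (h : (t₀, x) ∈ U) (v : Fin k → Rn n) :
    HasDerivAt (fun t => (pullbackForm (Φ t) η x v : ℝ)) 0 t₀ := by
  -- the target is read in the chart centred at the current position `y` of the flow
  obtain ⟨y, hy⟩ : ∃ y, y = Φ t₀ x := ⟨_, rfl⟩
  let z₀ : Rn n := extChartAt (𝓡 n) x x
  let F : ℝ × Rn n → Rn n := flowInChart Φ x y
  have hx : (extChartAt (𝓡 n) x).symm z₀ = x := extChartAt_to_inv x
  have hys : Φ t₀ x ∈ (extChartAt (𝓡 n) y).source := hy ▸ mem_extChartAt_source y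
  have hF : ContDiffAt ℝ (⊤ : ℕ∞) F (t₀, z₀) := hΦ.contDiffAt_flowInChart h hys
  have hF0 : F (t₀, z₀) = extChartAt (𝓡 n) y y := by
    simp only [F, flowInChart, hx, hy]
  have hcont : ContinuousAt (fun p : ℝ × Rn n => (p.1, (extChartAt (𝓡 n) x).symm p.2))
      (t₀, z₀) :=
    continuousAt_fst.prodMk
      (ContinuousAt.comp (g := (extChartAt (𝓡 n) x).symm) (continuousAt_extChartAt_symm x)
        continuousAt_snd)
  -- near `(t₀, z₀)` the flow is defined and stays in the chart
  have hgood : ∀ᶠ q in 𝓝 (t₀, x), q ∈ U ∧ Φ q.1 q.2 ∈ (extChartAt (𝓡 n) y).source :=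
    (show ∀ᶠ q in 𝓝 (t₀, x), q ∈ U from hΦ.isOpen.mem_nhds h).and ((hΦ.contMDiffAt h).continuousAt.eventually_mem
      ((isOpen_extChartAt_source y).mem_nhds hys))
  have hgood' : ∀ᶠ p in 𝓝 (t₀, z₀), (p.1, (extChartAt (𝓡 n) x).symm p.2) ∈ U ∧
      Φ p.1 ((extChartAt (𝓡 n) x).symm p.2) ∈ (extChartAt (𝓡 n) y).source := by
    refine Tendsto.eventually
      (p := fun q : ℝ × M => q ∈ U ∧ Φ q.1 q.2 ∈ (extChartAt (𝓡 n) y).source) hcont ?_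
    beta_reduce
    rw [hx]
    exact hgood
  have hflow : ∀ᶠ p in 𝓝 (t₀, z₀), fderiv ℝ F p (1, 0) = vfieldInChart X y (F p) := by
    have hdiff : ∀ᶠ p in 𝓝 (t₀, z₀), ContDiffAt ℝ 1 F p :=
      (hF.of_le ENat.LEInfty.out).eventually (by simp)
    filter_upwards [hgood', hdiff] with p hp hd
    have h1 := hΦ.hasDerivAt_flowInChart hp.1 hp.2
    have h2 : HasDerivAt (fun t : ℝ => (t, p.2)) ((1 : ℝ), (0 : Rn n)) p.1 :=
      (hasDerivAt_id p.1).prodMk (hasDerivAt_const p.1 p.2)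
    have h3 : HasDerivAt (fun t => F (t, p.2)) (fderiv ℝ F p (1, 0)) p.1 :=
      HasFDerivAt.comp_hasDerivAt (l := F) p.1 (hd.differentiableAt one_ne_zero).hasFDerivAt h2
    exact h3.unique h1
  have hη' : DifferentiableAt ℝ (formInChart η y) (F (t₀, z₀)) := by
    rw [hF0]
    exact (hη.contDiffAt (mem_extChartAt_target y)).differentiableAt (by simp)
  have hX' : DifferentiableAt ℝ (vfieldInChart X y) (F (t₀, z₀)) := by
    rw [hF0]
    exact hX y
  have key := hasDerivAt_pullback_flow (hF.of_le ENat.LEInfty.out) hX' hη' hflow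
  have hzero : lieDerivFlat (vfieldInChart X y) (formInChart η y) (F (t₀, z₀)) = 0 := by
    rw [hF0, ← lieDeriv_apply, hL]
    rfl
  rw [hzero] at key
  have key' : HasDerivAt (fun t => (formInChart η y (F (t, z₀))).compContinuousLinearMap
      ((fderiv ℝ F (t, z₀)).comp (ContinuousLinearMap.inr ℝ ℝ (Rn n))) v) 0 t₀ := by
    have h1 := ((ContinuousAlternatingMap.apply ℝ (Rn n) ℝ v).hasFDerivAt).comp_hasDerivAt t₀ key
    convert! h1 using 1
  refine key'.congr_of_eventuallyEq ?_
  have hline : ContinuousAt (fun t : ℝ => (t, x)) t₀ := by fun_prop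
  filter_upwards [hline.eventually hgood] with t ht
  exact hΦ.pullbackForm_apply_eq η ht.1 ht.2 v

/-- A local flow of `X` preserves every smooth form that it preserves infinitesimally. -/
theorem IsLocalFlow.pullbackForm_eq (hΦ : IsLocalFlow X U Φ)
    (hX : ∀ x, DifferentiableAt ℝ (vfieldInChart X x) (extChartAt (𝓡 n) x x)) {k : ℕ}
    {η : DForm n M k} (hη : IsSmoothForm η) (hL : lieDeriv X η = 0) {t : ℝ} {x : M}
    (h : (t, x) ∈ U) : pullbackForm (Φ t) η x = η x := by
  have h0 : ((0 : ℝ), x) ∈ U := hΦ.zero_mem t x h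
  have hid : Φ 0 =ᶠ[𝓝 x] id := by
    have hcont : ContinuousAt (fun z : M => ((0 : ℝ), z)) x := by fun_prop
    filter_upwards [hcont.eventually (hΦ.isOpen.mem_nhds h0)] with z hz
      using hΦ.map_zero z hz
  rw [← pullbackForm_eq_of_eventuallyEq_id η hid]
  ext v
  have hder := fun s (hs : (s, x) ∈ U) => hΦ.hasDerivAt_pullbackForm hX hη hL hs v
  exact (hΦ.isOpen_times x).is_const_of_deriv_eq_zero (hΦ.ordConnected x).isPreconnected
    (fun s hs => (hder s hs).differentiableAt.differentiableWithinAt)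
    (fun s hs => (hder s hs).deriv) h h0

end Flow

end LiouvilleTheorem

end

open LiouvilleTheorem in
theorem mainTheorem2 (N : ℕ) (M : Type*) [TopologicalSpace M] [ChartedSpace (Rn (2 * N)) M]
    [IsManifold (𝓡 (2 * N)) (⊤ : ℕ∞) M] (ω : SymplecticForm (2 * N) M)
    (H : M → ℝ) (hH : ContMDiff (𝓡 (2 * N)) 𝓘(ℝ, ℝ) (⊤ : ℕ∞) H) :
    -- the Liouville form is a volume form, and the Hamiltonian vector field is smooth
    (IsSmoothForm (liouvilleForm ω) ∧ ∀ x, liouvilleForm ω x ≠ 0) ∧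
    IsSmoothVField (hamiltonianVField ω H) ∧
    -- infinitesimal invariance and vanishing divergence
    lieDeriv (hamiltonianVField ω H) (liouvilleForm ω) = 0 ∧
    divergence (liouvilleForm ω) (hamiltonianVField ω H) = 0 ∧
    -- the divergence is characterised by its defining relation, so that the two are equivalent
    (∀ X : VField (2 * N) M, IsSmoothVField X →
      (∀ f : M → ℝ, (∀ x, lieDeriv X (liouvilleForm ω) x = f x • liouvilleForm ω x) ↔
        f = divergence (liouvilleForm ω) X) ∧
      (lieDeriv X (liouvilleForm ω) = 0 ↔ divergence (liouvilleForm ω) X = 0)) ∧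
    -- the Hamiltonian flow pulls the Liouville form back to itself
    (∀ (U : Set (ℝ × M)) (Φ : ℝ → M → M), IsLocalFlow (hamiltonianVField ω H) U Φ →
      ∀ t x, (t, x) ∈ U → pullbackForm (Φ t) (liouvilleForm ω) x = liouvilleForm ω x) := by
  have hne := liouvilleForm_ne_zero ω
  have hL := lieDeriv_liouvilleForm ω hH
  refine ⟨⟨isSmoothForm_liouvilleForm ω, hne⟩, isSmoothVField_hamiltonianVField ω hH, hL,
    (lieDeriv_eq_zero_iff_divergence_eq_zero hne _).1 hL, fun X _ =>
      ⟨lieDeriv_eq_smul_iff_eq_divergence hne X, lieDeriv_eq_zero_iff_divergence_eq_zero hne X⟩,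
    fun U Φ hΦ t x h => hΦ.pullbackForm_eq (fun x => ?_) (isSmoothForm_liouvilleForm ω) hL h⟩
  exact (contDiffAt_hamiltonianVField ω hH (mem_extChartAt_target x)).differentiableAt (by simp)
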